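/- Let $0<\alpha<\beta$, let $\rho=\alpha/\beta$, and let $L\ge 1$ be an integer. Let $\mathcal V$ be the set of real sequences $v=(v(k))_{k\ge 0}$ with $v(0)=1$, $v(k)\ge v(k+1)$ for all $k\ge0$, and $\lim_{k\to\infty}v(k)=0$. For $\theta>0$ and a real sequence $x$ put $$\|x\|_{L_2(g_\theta)}^2=\sum_{k\ge1}x(k)^2\,\theta^{-k},$$ let $L_2(g_\theta)$ be the space of sequences $x$ with $x(0)=0$ and $\|x\|_{L_2(g_\theta)}<\infty$, and let $\mathcal V\cap L_2(g_\theta)$ denote (disregarding the term of index $0$) the set of $v\in\mathcal V$ with $\|v\|_{L_2(g_\theta)}<\infty$. Consider the infinite system of differential equations $\dot u=F(u)$, that is, $$\dot u_t(k)=\alpha\bigl(u_t(k-1)^L-u_t(k)^L\bigr)-\beta\bigl(u_t(k)-u_t(k+1)\bigr),\qquad k\ge1,\ t\ge0,$$ for functions $u=(u_t)_{t\ge0}$ with values in $\mathcal V$, and let $$\tilde u(k)=\rho^{L^{k-1}+L^{k-2}+\cdots+1},\qquad k\ge0,$$ with an empty sum equal to $0$ (the exponent is $(L^k-1)/(L-1)$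 for $L\ge2$ and $k$ for $L=1$). Let $\rho\le\theta<1$. There exist $\gamma_\theta>0$ and $C_\theta<\infty$, depending only on $\alpha,\beta,L,\theta$, such that for every $u_0\in\mathcal V\cap L_2(g_\theta)$ there is a unique $\mathcal V$-valued solution $u=(u_t)_{t\ge0}$ of $\dot u=F(u)$ starting at $u_0$, and it satisfies, for all $t\ge0$, $u_t-\tilde u\in L_2(g_\theta)$ and $$\|u_t-\tilde u\|_{L_2(g_\theta)}\le e^{-\gamma_\theta t}\,C_\theta\,\|u_0-\tilde u\|_{L_2(g_\theta)}.$$ -/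

import Mathlib

namespace JoinShortestQueue

/-- Tail sequences of probability measures on `ℕ`. -/
def V : Set (ℕ → ℝ) :=
  {v | v 0 = 1 ∧ (∀ k, v (k + 1) ≤ v k) ∧ Filter.Tendsto v Filter.atTop (nhds 0)}

/-- `F₊(v)(k) = α (v(k-1)^L - v(k)^L)` for `k ≥ 1`, vanishing at `k = 0`. -/
def Fplus (α : ℝ) (L : ℕ) (v : ℕ → ℝ) : ℕ → ℝ
  | 0 => 0
  | k + 1 => α * (v k ^ L - v (k + 1) ^ L)

/-- `F₋(v)(k) = β (v(k) - v(k+1))` for `k ≥ 1`, vanishing at `k = 0`. -/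
def Fminus (β : ℝ) (v : ℕ → ℝ) : ℕ → ℝ
  | 0 => 0
  | k + 1 => β * (v (k + 1) - v (k + 2))

/-- The drift `F = F₊ - F₋`. -/
def F (α β : ℝ) (L : ℕ) (v : ℕ → ℝ) : ℕ → ℝ :=
  Fplus α L v - Fminus β v

/-- `u` restricted to `[0, ∞)` takes values in `V` and solves the infinite system of scalar
differential equations `u' = F(u)`. The derivative is one-sided at `t = 0`. Values of `u` at
negative times play no role. -/
def IsSolution (α β : ℝ) (L : ℕ) (u : ℝ → ℕ → ℝ) : Prop :=
  (∀ t, 0 ≤ t → u t ∈ V) ∧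
    ∀ t, 0 ≤ t → ∀ k, 1 ≤ k →
      HasDerivWithinAt (fun s => u s k) (F α β L (u t) k) (Set.Ici 0) t

/-- `ũ(k) = ρ ^ (L^(k-1) + ⋯ + L + 1)`. The exponent is `(L^k - 1)/(L - 1)` when `L ≥ 2`, and `k`
when `L = 1`. -/
noncomputable def uTilde (ρ : ℝ) (L : ℕ) (k : ℕ) : ℝ :=
  ρ ^ (∑ i ∈ Finset.range k, L ^ i)

/-- The geometric weight `g_θ(k) = θ^k` (only the indices `k ≥ 1` are used). -/
def g (θ : ℝ) (k : ℕ) : ℝ := θ ^ k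

/-- Finiteness of `∑_{k ≥ 1} x(k)² w(k)⁻¹`. -/
def FiniteL2 (w x : ℕ → ℝ) : Prop :=
  Summable fun k : ℕ => x (k + 1) ^ 2 * (w (k + 1))⁻¹

/-- The space `L₂(w)` of sequences vanishing at `0` with `∑_{k ≥ 1} x(k)² w(k)⁻¹ < ∞`. -/
def L2 (w : ℕ → ℝ) : Set (ℕ → ℝ) :=
  {x | x 0 = 0 ∧ FiniteL2 w x}

/-- The norm of `L₂(w)`. -/
noncomputable def L2norm (w x : ℕ → ℝ) : ℝ :=
  Real.sqrt (∑' k : ℕ, x (k + 1) ^ 2 * (w (k + 1))⁻¹)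

/-- The set written `V ∩ L₂(w)`: elements `v` of `V` whose terms with index `k ≥ 1` satisfy
`∑_{k ≥ 1} v(k)² w(k)⁻¹ < ∞` (the term `v(0) = 1` is disregarded). -/
def VL2 (w : ℕ → ℝ) : Set (ℕ → ℝ) :=
  {v | v ∈ V ∧ FiniteL2 w v}

end JoinShortestQueue

namespace JoinShortestQueue

open Set Filter Topology
open scoped NNReal

/-! ### Differential equations with a globally Lipschitz field, and Euler steps. -/

section GeneralODE

variable {E : Type*} [NormedAddCommGroup E] [NormedSpace ℝ E]

/-! Put `s = √θ` and `x(k) = s⁻ᵏ (u(k) - ũ(k))`, which turns the norm of `L₂(g θ)` into that of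
`ℓ²`. With the powers clamped to the unit interval the drift is globally Lipschitz in these
coordinates (`exists_lipschitz_field`), so a global solution exists. Small Euler steps preserve `V`
(`V.euler_step`), hence so does the flow (`mem_of_euler_step`), and on `V` clamping changes nothing.
Uniqueness must hold among all `V`-valued solutions, so it is proved in the sup norm.

For the decay, write `v^L - ũ^L = m (v - ũ)` with `0 ≤ m(k) ≤ 1 + L ρᵏ`. The tail sums `Y(k) = ∑ⱼ sʲ
|x(k+j)|` make the drift telescope: `Y(k)` grows at rate at most `b(k) = α s⁻¹ m(k-1) |x(k-1)| - β
|x(k)|`. If `m` were `1`, then `Y(k) = |x(k)| + s Y(k+1)` would give `⟨Y, b⟩ ≤ -β ‖x‖² + (α s⁻¹ - β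
s) ∑ₖ |x(k)| Y(k+1)`, whose last term is nonpositive because `ρ ≤ θ`. The excess `L ρᵏ` is summable
and is absorbed by a diagonal weight bounded away from `0` (`exists_weights`). The weighted norm of
`Y` is equivalent to `‖x‖`, so it decays exponentially (`exists_lyapunov`). Absolute values are not
differentiable, so all estimates are made on Euler steps and transferred by
`le_exp_mul_of_euler_step`. -/

theorem exists_solution_short [CompleteSpace E] {K : ℝ≥0} {G : E → E} (hG : LipschitzWith K G)
    (x₀ : E) : ∃ x : ℝ → E, x 0 = x₀ ∧ ∀ t ∈ Icc (0 : ℝ) (1 / (K + 1)),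
      HasDerivWithinAt x (G (x t)) (Icc (0 : ℝ) (1 / (K + 1))) t := by
  have hK : (0 : ℝ) < K + 1 := by positivity
  have h0 : (0 : ℝ) ∈ Icc (0 : ℝ) (1 / (K + 1)) := ⟨le_rfl, by positivity⟩
  -- On the ball of radius `‖G x₀‖` the field is at most `(K + 1) ‖G x₀‖`, so time `1 / (K + 1)` is
  -- always admissible. It does not depend on `x₀`, which makes iteration possible.
  have hPL : IsPicardLindelof (fun _ => G) (⟨0, h0⟩ : Icc (0 : ℝ) (1 / (K + 1))) x₀
      (‖G x₀‖₊) 0 ((K + 1) * ‖G x₀‖₊) K := by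
    refine ⟨fun t _ => hG.lipschitzOnWith, fun x _ => continuousOn_const, fun t _ x hx => ?_, ?_⟩
    · have h1 := hG.dist_le_mul x x₀
      have h2 : dist x x₀ ≤ ‖G x₀‖ := by simpa using hx
      have h3 : ‖G x‖ ≤ ‖G x₀‖ + dist (G x) (G x₀) := by
        rw [dist_eq_norm]
        calc ‖G x‖ = ‖G x₀ + (G x - G x₀)‖ := by congr 1; abel
          _ ≤ _ := norm_add_le _ _
      push_cast
      have h4 : (K : ℝ) * dist x x₀ ≤ K * ‖G x₀‖ := by gcongr
      linarith
    · have : max (1 / ((K : ℝ) + 1) - 0) (0 - 0) = 1 / (K + 1) := by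
        rw [sub_zero, sub_zero, max_eq_left (by positivity)]
      simp only [this]
      push_cast
      apply le_of_eq
      field_simp
      ring
  exact hPL.exists_eq_forall_mem_Icc_hasDerivWithinAt₀

theorem exists_solution_glue {G : E → E} {T ε : ℝ} (hT : 0 ≤ T) (hε : 0 ≤ ε) {x w : ℝ → E}
    (hx : ∀ t ∈ Icc 0 T, HasDerivWithinAt x (G (x t)) (Icc 0 T) t)
    (hw : ∀ t ∈ Icc 0 ε, HasDerivWithinAt w (G (w t)) (Icc 0 ε) t) (hxw : w 0 = x T) :
    ∃ z : ℝ → E, z 0 = x 0 ∧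
      ∀ t ∈ Icc 0 (T + ε), HasDerivWithinAt z (G (z t)) (Icc 0 (T + ε)) t := by
  set z : ℝ → E := fun t => if t ≤ T then x t else w (t - T) with hz
  have hz1 : ∀ t ∈ Icc 0 T, z t = x t := fun t ht => if_pos ht.2
  have hz2 : ∀ t ∈ Icc T (T + ε), z t = w (t - T) := by
    intro t ht
    rcases ht.1.eq_or_lt with h | h
    · subst h; simp [hz, hxw]
    · simp [hz, not_le.2 h]
  refine ⟨z, hz1 0 ⟨le_rfl, hT⟩, fun t ht => ?_⟩
  have hun : Icc 0 (T + ε) = Icc 0 T ∪ Icc T (T + ε) :=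
    (Icc_union_Icc_eq_Icc hT (by linarith)).symm
  rw [hun]
  refine HasDerivWithinAt.union ?_ ?_
  · by_cases h : t ∈ Icc 0 T
    · rw [hz1 t h]
      exact (hx t h).congr hz1 (hz1 t h)
    -- Off the closed interval the derivative within it holds vacuously.
    · exact HasFDerivWithinAt.of_notMem_closure (by rwa [isClosed_Icc.closure_eq])
  · by_cases h : t ∈ Icc T (T + ε)
    · rw [hz2 t h]
      refine HasDerivWithinAt.congr ?_ hz2 (hz2 t h)
      have h1 : t - T ∈ Icc 0 ε := ⟨by linarith [h.1], by linarith [h.2]⟩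
      have h2 := (hw _ h1).scomp t (s := Icc T (T + ε)) (h := fun r => r - T) (h' := 1)
        ((hasDerivWithinAt_id t _).sub_const T)
        (fun r hr => ⟨by linarith [hr.1], by linarith [hr.2]⟩)
      simpa [Function.comp_def] using h2
    · exact HasFDerivWithinAt.of_notMem_closure (by rwa [isClosed_Icc.closure_eq])

theorem exists_solution_Icc [CompleteSpace E] {K : ℝ≥0} {G : E → E} (hG : LipschitzWith K G)
    (x₀ : E) (n : ℕ) : ∃ x : ℝ → E, x 0 = x₀ ∧ ∀ t ∈ Icc (0 : ℝ) (n * (1 / (K + 1))),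
      HasDerivWithinAt x (G (x t)) (Icc (0 : ℝ) (n * (1 / (K + 1)))) t := by
  induction n with
  | zero =>
    refine ⟨fun _ => x₀, rfl, fun t _ => ?_⟩
    simp only [Nat.cast_zero, zero_mul, Icc_self]
    exact HasFDerivWithinAt.of_subsingleton subsingleton_singleton
  | succ n ih =>
    obtain ⟨x, hx0, hx⟩ := ih
    obtain ⟨w, hw0, hw⟩ := exists_solution_short hG (x (n * (1 / (K + 1))))
    obtain ⟨z, hz0, hz⟩ := exists_solution_glue (by positivity) (by positivity) hx hw hw0
    refine ⟨z, hz0.trans hx0, ?_⟩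
    have : ((n + 1 : ℕ) : ℝ) * (1 / ((K : ℝ) + 1)) = n * (1 / (K + 1)) + 1 / (K + 1) := by
      push_cast; ring
    rwa [this]

/-- A globally Lipschitz vector field has forward solutions for all times. -/
theorem exists_solution_Ici [CompleteSpace E] {K : ℝ≥0} {G : E → E} (hG : LipschitzWith K G)
    (x₀ : E) : ∃ x : ℝ → E, x 0 = x₀ ∧ ∀ t, 0 ≤ t →
      HasDerivWithinAt x (G (x t)) (Ici 0) t := by
  choose X hX0 hX using exists_solution_Icc hG x₀
  set ε : ℝ := 1 / (K + 1) with hεdef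
  have hε : 0 < ε := by positivity
  have hright : ∀ n : ℕ, ∀ t ∈ Ico (0 : ℝ) (n * ε),
      HasDerivWithinAt (X n) (G (X n t)) (Ici t) t := fun n t ht =>
    (hX n t (Ico_subset_Icc_self ht)).mono_of_mem_nhdsWithin
      (mem_of_superset (Icc_mem_nhdsGE ht.2) (Icc_subset_Icc_left ht.1))
  have hcoh : ∀ m n : ℕ, m ≤ n → EqOn (X m) (X n) (Icc 0 (m * ε)) := by
    intro m n hmn
    have hle : (m : ℝ) * ε ≤ n * ε := by gcongr
    refine ODE_solution_unique (v := fun _ => G) (fun _ => hG)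
      (fun t ht => (hX m t ht).continuousWithinAt) (hright m)
      (fun t ht => ((hX n t ⟨ht.1, ht.2.trans hle⟩).continuousWithinAt).mono
        (Icc_subset_Icc_right hle))
      (fun t ht => hright n t ⟨ht.1, ht.2.trans_le hle⟩) (by rw [hX0, hX0])
  have hceil : ∀ t, t ≤ (⌈t / ε⌉₊ : ℝ) * ε := fun t => (div_le_iff₀ hε).1 (Nat.le_ceil _)
  set x : ℝ → E := fun t => X ⌈t / ε⌉₊ t with hx
  have hxX : ∀ n : ℕ, EqOn x (X n) (Icc 0 (n * ε)) := by
    intro n t ht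
    refine hcoh _ n ?_ ⟨ht.1, hceil t⟩
    exact Nat.ceil_le.2 ((div_le_iff₀ hε).2 ht.2)
  refine ⟨x, hX0 _, fun t ht => ?_⟩
  -- The extra interval makes `t < n * ε`, so `[0, n ε]` is a neighbourhood of `t` within `[0, ∞)`.
  set n := ⌈t / ε⌉₊ + 1 with hn
  have htn : t < n * ε := by
    have := hceil t
    rw [hn]; push_cast; linarith
  have hmem : t ∈ Icc 0 (n * ε) := ⟨ht, htn.le⟩
  rw [hxX n hmem]
  refine ((hX n t hmem).congr (hxX n) (hxX n hmem)).mono_of_mem_nhdsWithin ?_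
  rw [← Ici_inter_Iic]
  exact inter_mem_nhdsWithin _ (Iic_mem_nhds htn)

/-- A Grönwall estimate for a Lipschitz functional that is controlled along Euler steps. -/
theorem le_exp_mul_of_euler_step {G : E → E} {x : ℝ → E} {f : E → ℝ} {C κ h₀ : ℝ}
    (hC : 0 ≤ C) (hf : ∀ a b, f a ≤ f b + C * ‖a - b‖) (hh₀ : 0 < h₀)
    (hx : ∀ t, 0 ≤ t → HasDerivWithinAt x (G (x t)) (Ici 0) t)
    (hstep : ∀ t, 0 ≤ t → ∀ h, 0 < h → h ≤ h₀ → f (x t + h • G (x t)) ≤ (1 + κ * h) * f (x t))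
    {t : ℝ} (ht : 0 ≤ t) : f (x t) ≤ Real.exp (κ * t) * f (x 0) := by
  have hfc : Continuous f := by
    refine (LipschitzWith.of_le_add_mul (Real.toNNReal C) fun a b => ?_).continuous
    rw [Real.coe_toNNReal C hC, dist_eq_norm]
    exact hf a b
  have hxc : ContinuousOn x (Ici 0) := fun r hr => (hx r hr).continuousWithinAt
  have key := le_gronwallBound_of_liminf_deriv_right_le (f := fun r => f (x r))
    (f' := fun r => κ * f (x r)) (δ := f (x 0)) (K := κ) (ε := 0) (a := 0) (b := t)
    (hfc.comp_continuousOn (hxc.mono Icc_subset_Ici_self)) ?_ le_rfl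
    (fun r _ => by simp) t ⟨ht, le_rfl⟩
  · rw [gronwallBound_ε0, sub_zero, mul_comm] at key
    exact key
  intro r hr q hq
  apply Eventually.frequently
  have hd : HasDerivWithinAt x (G (x r)) (Ioi r) r :=
    (hx r hr.1).mono fun z hz => hr.1.trans (le_of_lt hz)
  set η := q - κ * f (x r) with hη
  have hηpos : 0 < η := sub_pos.2 hq
  have hlo := hasDerivWithinAt_iff_isLittleO.1 hd
  have hC1 : 0 < C + 1 := by linarith
  have hev := hlo.def (show 0 < η / (2 * (C + 1)) by positivity)
  have hnear : ∀ᶠ z in 𝓝[>] r, z ∈ Ioc r (r + h₀) := Ioc_mem_nhdsGT (by linarith)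
  filter_upwards [hev, hnear] with z hz hzr
  have hpos : 0 < z - r := sub_pos.2 hzr.1
  rw [Real.norm_of_nonneg hpos.le] at hz
  have h1 := hf (x z) (x r + (z - r) • G (x r))
  have h2 := hstep r hr.1 (z - r) hpos (by linarith [hzr.2])
  have h3 : ‖x z - (x r + (z - r) • G (x r))‖ ≤ η / (2 * (C + 1)) * (z - r) := by
    rwa [sub_sub] at hz
  have h4 : C * ‖x z - (x r + (z - r) • G (x r))‖ ≤ η / 2 * (z - r) := by
    calc _ ≤ (C + 1) * (η / (2 * (C + 1)) * (z - r)) := by gcongr; linarith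
      _ = η / 2 * (z - r) := by field_simp
  rw [inv_mul_lt_iff₀ hpos]
  have h5 : f (x z) - f (x r) ≤ (z - r) * (κ * f (x r) + η / 2) := by
    calc f (x z) - f (x r) ≤ (1 + κ * (z - r)) * f (x r) + η / 2 * (z - r) - f (x r) := by linarith
      _ = _ := by ring
  refine h5.trans_lt ?_
  gcongr
  linarith

/-- A closed set that is invariant under small Euler steps is forward invariant. -/
theorem mem_of_euler_step {K : ℝ≥0} {G : E → E} (hG : LipschitzWith K G) {S : Set E}
    (hS : IsClosed S) {h₀ : ℝ} (hh₀ : 0 < h₀)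
    (hstep : ∀ a ∈ S, ∀ h, 0 < h → h ≤ h₀ → a + h • G a ∈ S) {x : ℝ → E}
    (hx : ∀ t, 0 ≤ t → HasDerivWithinAt x (G (x t)) (Ici 0) t) (hx0 : x 0 ∈ S)
    {t : ℝ} (ht : 0 ≤ t) : x t ∈ S := by
  have hne : S.Nonempty := ⟨_, hx0⟩
  have key := le_exp_mul_of_euler_step (f := fun a => Metric.infDist a S) (C := 1) (κ := K)
    zero_le_one (fun a b => by
      rw [one_mul, ← dist_eq_norm]; exact Metric.infDist_le_infDist_add_dist) hh₀ hx
    (fun r _ h hh hhh₀ => ?_) ht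
  · rw [Metric.infDist_zero_of_mem hx0, mul_zero] at key
    exact (hS.mem_iff_infDist_zero hne).2 (le_antisymm key Metric.infDist_nonneg)
  -- Compare with the Euler step from any `p ∈ S`, which stays in `S`: the distance to `S` is
  -- multiplied by at most `1 + K h`. Starting from `0`, it remains `0`.
  have hfac : (0 : ℝ) < 1 + K * h := by positivity
  rw [← div_le_iff₀' hfac]
  refine (Metric.le_infDist hne).2 fun p hp => ?_
  rw [div_le_iff₀' hfac]
  refine (Metric.infDist_le_dist_of_mem (hstep p hp h hh hhh₀)).trans ?_
  refine (dist_add_add_le _ _ _ _).trans ?_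
  rw [dist_smul₀, Real.norm_of_nonneg hh.le]
  have := hG.dist_le_mul (x r) p
  nlinarith [mul_le_mul_of_nonneg_left this hh.le]

end GeneralODE

/-! ### Operators on `ℓ²`. -/

/-- The Hilbert space of square summable real sequences. -/
abbrev EllTwo : Type := lp (fun _ : ℕ => ℝ) 2

theorem memℓp_two_iff {a : ℕ → ℝ} : Memℓp a 2 ↔ Summable fun k => a k ^ 2 := by
  rw [memℓp_gen_iff (by norm_num)]
  refine summable_congr fun k => ?_
  norm_num

theorem EllTwo.summable_sq (x : EllTwo) : Summable fun k => x k ^ 2 :=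
  memℓp_two_iff.1 (lp.memℓp x)

theorem EllTwo.norm_sq (x : EllTwo) : ‖x‖ ^ 2 = ∑' k, x k ^ 2 := by
  have := lp.norm_rpow_eq_tsum (p := 2) (by norm_num) x
  norm_num at this
  exact this

theorem EllTwo.norm_le_of_abs_le {x y : EllTwo} (h : ∀ k, |x k| ≤ |y k|) : ‖x‖ ≤ ‖y‖ :=
  lp.norm_mono two_ne_zero h

theorem EllTwo.hasSum_inner (x y : EllTwo) : HasSum (fun k => x k * y k) (inner ℝ x y) := by
  have := lp.hasSum_inner (𝕜 := ℝ) x y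
  simpa [mul_comm] using this

theorem hasSum_sq_pred {x : ℕ → ℝ} (hx : Summable fun k => x k ^ 2) :
    HasSum (fun k => x (k - 1) ^ 2) (∑' k, x k ^ 2 + x 0 ^ 2) := by
  have := (hasSum_nat_add_iff (f := fun k => x (k - 1) ^ 2) 1).1 (by simpa using hx.hasSum)
  simpa using this

theorem summable_sq_succ {x : ℕ → ℝ} (hx : Summable fun k => x k ^ 2) :
    Summable fun k => x (k + 1) ^ 2 :=
  (summable_nat_add_iff (f := fun k => x k ^ 2) 1).2 hx

/-- A sequence dominated by nearest-neighbour sums of a square summable one. -/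
theorem summable_sq_of_abs_le_neighbours {a x : ℕ → ℝ} {c : ℝ} (hx : Summable fun k => x k ^ 2)
    (h : ∀ k, |a k| ≤ c * (|x (k - 1)| + |x k| + |x (k + 1)|)) :
    (Summable fun k => a k ^ 2) ∧ ∑' k, a k ^ 2 ≤ 12 * c ^ 2 * ∑' k, x k ^ 2 := by
  have h1 := hasSum_sq_pred hx
  have h2 := hx.hasSum
  have h3 := (summable_sq_succ hx).hasSum
  have hsum := ((h1.add h2).add h3).mul_left (3 * c ^ 2)
  have hle : ∀ k, a k ^ 2 ≤ 3 * c ^ 2 * (x (k - 1) ^ 2 + x k ^ 2 + x (k + 1) ^ 2) := by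
    intro k
    have hk : |a k| ^ 2 ≤ (c * (|x (k - 1)| + |x k| + |x (k + 1)|)) ^ 2 :=
      pow_le_pow_left₀ (abs_nonneg _) (h k) 2
    rw [sq_abs] at hk
    rw [← sq_abs (x (k - 1)), ← sq_abs (x k), ← sq_abs (x (k + 1))]
    refine hk.trans ?_
    rw [mul_pow, mul_comm 3, mul_assoc]
    refine mul_le_mul_of_nonneg_left ?_ (sq_nonneg c)
    nlinarith [sq_nonneg (|x (k - 1)| - |x k|), sq_nonneg (|x (k - 1)| - |x (k + 1)|),
      sq_nonneg (|x k| - |x (k + 1)|)]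
  have hs : Summable fun k => a k ^ 2 := hsum.summable.of_nonneg_of_le (fun _ => sq_nonneg _) hle
  refine ⟨hs, (hs.tsum_le_tsum hle hsum.summable).trans ?_⟩
  rw [hsum.tsum_eq]
  -- Since `0 - 1 = 0` in `ℕ`, the predecessor sum counts `x 0` twice and is at most two full sums.
  -- The three neighbours thus give four sums, and the square of three terms a factor `3`: hence
  -- `12`.
  have h4 : x 0 ^ 2 ≤ ∑' k, x k ^ 2 := hx.le_tsum 0 fun _ _ => sq_nonneg _
  have h5 : ∑' k, x (k + 1) ^ 2 ≤ ∑' k, x k ^ 2 := by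
    have := hx.tsum_eq_zero_add
    nlinarith [sq_nonneg (x 0)]
  nlinarith [sq_nonneg c]

theorem EllTwo.norm_le_of_abs_le_neighbours {a x : EllTwo} {c : ℝ} (hc : 0 ≤ c)
    (h : ∀ k, |a k| ≤ c * (|x (k - 1)| + |x k| + |x (k + 1)|)) : ‖a‖ ≤ 4 * c * ‖x‖ := by
  refine (pow_le_pow_iff_left₀ (norm_nonneg _) (by positivity) two_ne_zero).1 ?_
  have := (summable_sq_of_abs_le_neighbours x.summable_sq h).2
  rw [← a.norm_sq, ← x.norm_sq] at this
  nlinarith [mul_nonneg (sq_nonneg c) (sq_nonneg ‖x‖)]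

/-- The left shift. -/
noncomputable def leftShift : EllTwo →L[ℝ] EllTwo :=
  LinearMap.mkContinuous
    { toFun := fun x => ⟨fun k => x (k + 1), memℓp_two_iff.2 (summable_sq_succ x.summable_sq)⟩
      map_add' := fun _ _ => rfl
      map_smul' := fun _ _ => rfl } 1 fun x => by
    refine (pow_le_pow_iff_left₀ (norm_nonneg _) (by positivity) two_ne_zero).1 ?_
    rw [one_mul, EllTwo.norm_sq, EllTwo.norm_sq, x.summable_sq.tsum_eq_zero_add]
    exact le_add_of_nonneg_left (sq_nonneg _)

theorem leftShift_apply (x : EllTwo) (k : ℕ) : leftShift x k = x (k + 1) := rfl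

theorem norm_leftShift_le : ‖leftShift‖ ≤ 1 := LinearMap.mkContinuous_norm_le _ zero_le_one _

theorem exists_diagonal {w : ℕ → ℝ} (hw : ∀ k, |w k| ≤ 1) :
    ∃ D : EllTwo →L[ℝ] EllTwo, (∀ x k, D x k = w k * x k) ∧ ∀ x, ‖D x‖ ≤ ‖x‖ := by
  have hle : ∀ (x : ℕ → ℝ) k, (w k * x k) ^ 2 ≤ x k ^ 2 := fun x k => by
    rw [sq_le_sq, abs_mul]
    exact mul_le_of_le_one_left (abs_nonneg _) (hw k)
  have hmem : ∀ x : EllTwo, Memℓp (fun k => w k * x k) 2 := fun x =>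
    memℓp_two_iff.2 (x.summable_sq.of_nonneg_of_le (fun _ => sq_nonneg _) (hle x))
  have hnorm : ∀ x : EllTwo, ‖(⟨fun k => w k * x k, hmem x⟩ : EllTwo)‖ ≤ 1 * ‖x‖ := fun x => by
    rw [one_mul]
    exact EllTwo.norm_le_of_abs_le fun k => sq_le_sq.1 (hle x k)
  refine ⟨LinearMap.mkContinuous
    { toFun := fun x => ⟨fun k => w k * x k, hmem x⟩
      map_add' := fun x y => by ext k; exact mul_add _ _ _
      map_smul' := fun c x => by ext k; exact mul_left_comm _ _ _ } 1 hnorm, fun _ _ => rfl,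
    fun x => ?_⟩
  simpa using hnorm x

/-- The operator of geometrically weighted tail sums. -/
theorem exists_tailSum {s : ℝ} (hs0 : 0 ≤ s) (hs1 : s < 1) :
    ∃ T : EllTwo →L[ℝ] EllTwo, (∀ x k, T x k = x k + s * T x (k + 1)) ∧
      (∀ x, T (x - s • leftShift x) = x) ∧
      ∀ x : EllTwo, (∀ k, 0 ≤ x k) → ∀ k, 0 ≤ T x k := by
  set t : EllTwo →L[ℝ] EllTwo := s • leftShift with ht
  have htn : ‖t‖ < 1 := by
    refine lt_of_le_of_lt ?_ hs1
    rw [ht, norm_smul, Real.norm_of_nonneg hs0]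
    exact mul_le_of_le_one_right hs0 norm_leftShift_le
  have h1 := geom_series_mul_neg t htn
  have h2 := mul_neg_geom_series t htn
  set T := ∑' i : ℕ, t ^ i
  have hT : ∀ x k, T x k = x k + s * T x (k + 1) := fun x k => by
    have h3 : T x - s • leftShift (T x) = x := by
      have := congrArg (fun A : EllTwo →L[ℝ] EllTwo => A x) h2
      simpa [ht] using this
    have h4 := congrArg (fun y : EllTwo => y k) h3
    simp only [lp.coeFn_sub, lp.coeFn_smul, Pi.sub_apply, Pi.smul_apply, smul_eq_mul,
      leftShift_apply] at h4
    linarith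
  refine ⟨T, hT, fun x => ?_, fun x hx k => ?_⟩
  · have := congrArg (fun A : EllTwo →L[ℝ] EllTwo => A x) h1
    simpa [ht] using this
  -- Iterating the recursion bounds `T x k` below by `sⁿ T x (k + n)`, which tends to `0` because `T
  -- x` is bounded.
  · have h5 : ∀ n : ℕ, s ^ n * T x (k + n) ≤ T x k := by
      intro n
      induction n with
      | zero => simp
      | succ n ih =>
        refine le_trans ?_ ih
        rw [pow_succ, mul_assoc]
        refine mul_le_mul_of_nonneg_left ?_ (pow_nonneg hs0 n)
        rw [hT x (k + n), add_assoc k n 1]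
        linarith [hx (k + n)]
    have h6 : ∀ n : ℕ, -(s ^ n * ‖T x‖) ≤ T x k := fun n => by
      refine le_trans ?_ (h5 n)
      rw [← mul_neg]
      refine mul_le_mul_of_nonneg_left ?_ (pow_nonneg hs0 n)
      exact (abs_le.1 (lp.norm_apply_le_norm two_ne_zero (T x) (k + n))).1
    have h7 : Tendsto (fun n : ℕ => -(s ^ n * ‖T x‖)) atTop (𝓝 0) := by
      simpa using ((tendsto_pow_atTop_nhds_zero_of_lt_one hs0 hs1).mul_const ‖T x‖).neg
    exact le_of_tendsto' h7 h6

/-! ### The Lyapunov norm built from tail sums. -/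

/-- The coordinatewise absolute value. -/
noncomputable def absSeq (x : EllTwo) : EllTwo :=
  ⟨fun k => |x k|, memℓp_two_iff.2 (by simpa using x.summable_sq)⟩

theorem absSeq_apply (x : EllTwo) (k : ℕ) : absSeq x k = |x k| := rfl

theorem norm_absSeq (x : EllTwo) : ‖absSeq x‖ = ‖x‖ :=
  le_antisymm (EllTwo.norm_le_of_abs_le fun k => by simp [absSeq_apply])
    (EllTwo.norm_le_of_abs_le fun k => by simp [absSeq_apply])

/-- The flux controlling the growth of weighted tail sums along an Euler step. -/
noncomputable def tailFlux (α β s : ℝ) (M : ℕ → ℝ) (x : ℕ → ℝ) : ℕ → ℝ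
  | 0 => -(β * |x 0|)
  | k + 1 => α * s⁻¹ * M k * |x k| - β * |x (k + 1)|

theorem abs_tailFlux_le {α β s B : ℝ} (hα : 0 ≤ α) (hβ : 0 ≤ β) (hs : 0 ≤ s) {M : ℕ → ℝ}
    (hM0 : ∀ k, 0 ≤ M k) (hMB : ∀ k, M k ≤ B) (x : ℕ → ℝ) (k : ℕ) :
    |tailFlux α β s M x k| ≤ (α * s⁻¹ * B + β) * (|x (k - 1)| + |x k| + |x (k + 1)|) := by
  have hB : 0 ≤ B := (hM0 0).trans (hMB 0)
  have hp : 0 ≤ α * s⁻¹ := by positivity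
  cases k with
  | zero =>
    rw [tailFlux, abs_neg, abs_mul, abs_abs, abs_of_nonneg hβ]
    have h1 : 0 ≤ α * s⁻¹ * B * |x 0| := by positivity
    have h2 : 0 ≤ (α * s⁻¹ * B + β) * |x (0 + 1)| := by positivity
    have h3 : 0 ≤ β * |x 0| := by positivity
    simp only [Nat.zero_sub]
    nlinarith
  | succ k =>
    rw [tailFlux]
    refine (abs_sub _ _).trans ?_
    have h0 : 0 ≤ α * s⁻¹ * M k * |x k| := mul_nonneg (mul_nonneg hp (hM0 k)) (abs_nonneg _)
    have h0' : 0 ≤ β * |x (k + 1)| := by positivity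
    rw [abs_of_nonneg h0, abs_of_nonneg h0']
    have h1 : α * s⁻¹ * M k * |x k| ≤ α * s⁻¹ * B * |x k| := by gcongr; exact hMB k
    have h2 : 0 ≤ (α * s⁻¹ * B + β) * |x (k + 1 + 1)| := by positivity
    have h3 : 0 ≤ β * |x k| := by positivity
    have h4 : 0 ≤ α * s⁻¹ * B * |x (k + 1)| := by positivity
    simp only [Nat.add_sub_cancel]
    nlinarith

theorem tailFlux_mono {α β s : ℝ} (hα : 0 ≤ α) (hs : 0 ≤ s) {m M : ℕ → ℝ}
    (h : ∀ k, m k ≤ M k) (x : ℕ → ℝ) (k : ℕ) : tailFlux α β s m x k ≤ tailFlux α β s M x k := by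
  cases k with
  | zero => rfl
  | succ k =>
    rw [tailFlux, tailFlux]
    gcongr
    exact h k

/-- Shifting the gain part of `b` by one index pairs `|x k|` with `Y (k + 1)`. The loss part pairs
it with `Y k = |x k| + s * Y (k + 1)`, so the cross terms have a favourable sign by `hαβ` and `hwM`,
and only `-β (w k)² (x k)²` is left. -/
theorem inner_tail_flux_le {α β s : ℝ} (hs : 0 < s) (hαβ : α ≤ β * s ^ 2) {M w : ℕ → ℝ}
    (hα : 0 ≤ α) (hwM : ∀ k, w (k + 1) ^ 2 * M k ≤ w k ^ 2) {D : EllTwo →L[ℝ] EllTwo}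
    (hD : ∀ x k, D x k = w k * x k) {x Y b : EllTwo} (hY0 : ∀ k, 0 ≤ Y k)
    (hY : ∀ k, Y k = |x k| + s * Y (k + 1)) (hb : ∀ k, b k = tailFlux α β s M x k) :
    inner ℝ (D Y) (D b) ≤ -β * ‖D x‖ ^ 2 := by
  have h1 := EllTwo.hasSum_inner (D Y) (D b)
  have h2 := (EllTwo.hasSum_inner (D Y) (D (absSeq x))).mul_left β
  have h3 := h1.add h2
  have h4 : HasSum (fun k => D Y (k + 1) * D b (k + 1) + β * (D Y (k + 1) * D (absSeq x) (k + 1)))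
      (inner ℝ (D Y) (D b) + β * inner ℝ (D Y) (D (absSeq x))) := by
    refine (hasSum_nat_add_iff 1 (f := fun k => D Y k * D b k + β * (D Y k * D (absSeq x) k))).2 ?_
    have : D Y 0 * D b 0 + β * (D Y 0 * D (absSeq x) 0) = 0 := by
      simp only [hD, hb, tailFlux, absSeq_apply]; ring
    simpa [this] using h3
  have h5 := h4.sub h2
  rw [add_sub_cancel_right] at h5
  have h6 : HasSum (fun k => D x k ^ 2) (‖D x‖ ^ 2) := by
    rw [EllTwo.norm_sq]; exact (D x).summable_sq.hasSum
  refine hasSum_le (fun k => ?_) h5 (h6.mul_left (-β))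
  simp only [hD, hb, tailFlux, absSeq_apply]
  have h7 : α * s⁻¹ ≤ β * s := by
    rw [← div_eq_mul_inv, div_le_iff₀ hs]; linarith
  have hp : 0 ≤ α * s⁻¹ := by positivity
  have h8 : α * s⁻¹ * (w (k + 1) ^ 2 * M k) * (|x k| * Y (k + 1))
      ≤ β * s * w k ^ 2 * (|x k| * Y (k + 1)) := by
    refine mul_le_mul_of_nonneg_right ?_ (mul_nonneg (abs_nonneg _) (hY0 _))
    calc _ ≤ α * s⁻¹ * w k ^ 2 := by gcongr; exact hwM k
      _ ≤ _ := by gcongr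
  have h9 := sq_abs (x k)
  rw [hY k, mul_pow, ← h9]
  nlinarith

/-- A norm, equivalent to that of `ℓ²`, that contracts along Euler steps dominated by
`tailFlux`. -/
theorem exists_lyapunov {α β s B δ : ℝ} (hα : 0 ≤ α) (hβ : 0 < β) (hs0 : 0 < s) (hs1 : s < 1)
    (hαβ : α ≤ β * s ^ 2) {M w : ℕ → ℝ} (hM0 : ∀ k, 0 ≤ M k) (hMB : ∀ k, M k ≤ B) (hδ : 0 < δ)
    (hwδ : ∀ k, δ ≤ w k) (hw1 : ∀ k, w k ≤ 1) (hwM : ∀ k, w (k + 1) ^ 2 * M k ≤ w k ^ 2) :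
    ∃ (N : EllTwo → ℝ) (C C' c h₀ : ℝ), 0 ≤ C ∧ 0 ≤ C' ∧ 0 < c ∧ 0 < h₀ ∧
      (∀ a b, N a ≤ N b + C * ‖a - b‖) ∧ (∀ x, N x ≤ C * ‖x‖) ∧ (∀ x, ‖x‖ ≤ C' * N x) ∧
      ∀ (x z : EllTwo) (m : ℕ → ℝ) (h : ℝ), (∀ k, 0 ≤ m k) → (∀ k, m k ≤ M k) → 0 < h → h ≤ h₀ →
        (∀ k, |z k| ≤ |x k| + h * (tailFlux α β s m x k - s * tailFlux α β s m x (k + 1))) →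
        N z ≤ (1 - c * h) * N x := by
  obtain ⟨T, hT, hTinv, hTpos⟩ := exists_tailSum hs0.le hs1
  have hw0 : ∀ k, 0 < w k := fun k => hδ.trans_le (hwδ k)
  obtain ⟨D, hD, hD1⟩ := exists_diagonal (w := w) fun k => by
    rw [abs_of_pos (hw0 k)]; exact hw1 k
  have hTmono : ∀ x y : EllTwo, (∀ k, x k ≤ y k) → ∀ k, T x k ≤ T y k := fun x y h k => by
    have := hTpos (y - x) (fun k => by simpa using h k) k
    rw [map_sub] at this
    simpa using this
  have hDmono : ∀ x y : EllTwo, (∀ k, 0 ≤ x k) → (∀ k, x k ≤ y k) → ‖D x‖ ≤ ‖D y‖ :=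
    fun x y h0 h => EllTwo.norm_le_of_abs_le fun k => by
      rw [hD, hD, abs_mul, abs_mul, abs_of_nonneg (h0 k), abs_of_nonneg ((h0 k).trans (h k))]
      gcongr
      exact h k
  have hDδ : ∀ x, δ * ‖x‖ ≤ ‖D x‖ := fun x => by
    have : ‖δ • x‖ ≤ ‖D x‖ := EllTwo.norm_le_of_abs_le fun k => by
      rw [hD, lp.coeFn_smul, Pi.smul_apply, smul_eq_mul, abs_mul, abs_mul, abs_of_pos hδ,
        abs_of_pos (hw0 k)]
      gcongr
      exact hwδ k
    rwa [norm_smul, Real.norm_of_nonneg hδ.le] at this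
  have habs0 : ∀ (x : EllTwo) k, 0 ≤ absSeq x k := fun x k => abs_nonneg _
  have hTabs0 : ∀ (x : EllTwo) k, 0 ≤ T (absSeq x) k := fun x => hTpos _ (habs0 x)
  set N : EllTwo → ℝ := fun x => ‖D (T (absSeq x))‖ with hN
  set C : ℝ := ‖T‖ + 1 with hC
  have hC1 : 0 < C := by positivity
  have hNC : ∀ x, N x ≤ C * ‖x‖ := fun x => by
    refine (hD1 _).trans ((T.le_opNorm _).trans ?_)
    rw [norm_absSeq]
    gcongr
    linarith
  have hNsub : ∀ a b, N a ≤ N b + N (a - b) := fun a b => by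
    refine le_trans ?_ (norm_add_le _ _)
    rw [← map_add, ← map_add]
    refine hDmono _ _ (hTabs0 a) (hTmono _ _ fun k => ?_)
    simp only [lp.coeFn_add, lp.coeFn_sub, Pi.add_apply, Pi.sub_apply, absSeq_apply]
    have := abs_add_le (b k) (a k - b k)
    rwa [add_sub_cancel] at this
  have hNδ : ∀ x, δ * ‖x‖ ≤ N x := fun x => by
    refine le_trans ?_ (hDδ _)
    gcongr
    refine EllTwo.norm_le_of_abs_le fun k => ?_
    rw [abs_of_nonneg (hTabs0 x k), hT]
    exact le_add_of_nonneg_right (mul_nonneg hs0.le (hTabs0 x _))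
  set Cb : ℝ := 4 * (α * s⁻¹ * B + β) with hCb
  have hB : 0 ≤ B := (hM0 0).trans (hMB 0)
  have hcb0 : 0 ≤ α * s⁻¹ * B + β := by positivity
  have hCb0 : 0 < Cb := by rw [hCb]; positivity
  -- In `‖D Y + h D b‖²` the cross term gains `2 h β δ² ‖x‖²`. The bound `h ≤ β δ² / Cb²` lets the
  -- quadratic term consume at most half of it, and `N x ≤ C ‖x‖` turns the rest into `2 c h (N
  -- x)²`.
  set c : ℝ := β * δ ^ 2 / (2 * C ^ 2) with hc
  have hcpos : 0 < c := by positivity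
  refine ⟨N, C, δ⁻¹, c, min (β * δ ^ 2 / Cb ^ 2) (1 / c), hC1.le, (inv_pos.2 hδ).le, hcpos,
    by positivity, fun a b => (hNsub a b).trans (by gcongr; exact hNC _), hNC, fun x => ?_,
    fun x z m h hm0 hmM hh hhh₀ hz => ?_⟩
  · rw [← div_eq_inv_mul, le_div_iff₀ hδ, mul_comm]
    exact hNδ x
  have hflux := abs_tailFlux_le hα hβ.le hs0.le hM0 hMB x
  let b : EllTwo := ⟨tailFlux α β s M x,
    memℓp_two_iff.2 (summable_sq_of_abs_le_neighbours x.summable_sq hflux).1⟩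
  have hb : ∀ k, b k = tailFlux α β s M x k := fun _ => rfl
  have hbn : ‖b‖ ≤ Cb * ‖x‖ := EllTwo.norm_le_of_abs_le_neighbours hcb0 hflux
  let b' : EllTwo := ⟨tailFlux α β s m x, memℓp_two_iff.2 (summable_sq_of_abs_le_neighbours
    x.summable_sq (abs_tailFlux_le hα hβ.le hs0.le hm0 (fun k => (hmM k).trans (hMB k)) x)).1⟩
  have hbb : ∀ k, b' k ≤ b k := fun k => tailFlux_mono hα hs0.le hmM x k
  -- The difference `b k - s * b (k + 1)` is not monotone in `m`, but `b` is. Thus `m` is replaced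
  -- by `M` only after `T` has undone the difference.
  have hTz : ∀ k, T (absSeq z) k ≤ (T (absSeq x) + h • b) k := fun k => by
    have : T (absSeq x) + h • b' = T (absSeq x + h • (b' - s • leftShift b')) := by
      rw [map_add, map_smul, hTinv]
    calc T (absSeq z) k ≤ (T (absSeq x) + h • b') k := by
          rw [this]
          exact hTmono _ _ hz k
      _ ≤ _ := add_le_add_right (mul_le_mul_of_nonneg_left (hbb k) hh.le) _
  have hNz : N z ≤ ‖D (T (absSeq x)) + h • D b‖ := by
    rw [← map_smul, ← map_add]
    exact hDmono _ _ (hTabs0 z) hTz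
  have hinner := inner_tail_flux_le hs0 hαβ hα hwM hD (hTabs0 x)
    (fun k => by rw [hT (absSeq x) k]; rfl) hb
  have hNx0 : 0 ≤ N x := norm_nonneg _
  have hDb : ‖D b‖ ≤ Cb * ‖x‖ := (hD1 b).trans hbn
  have hsq : N z ^ 2 ≤ (1 - 2 * (c * h)) * N x ^ 2 := by
    have e1 : N z ^ 2 ≤ ‖D (T (absSeq x)) + h • D b‖ ^ 2 :=
      pow_le_pow_left₀ (norm_nonneg _) hNz 2
    rw [norm_add_sq_real, inner_smul_right, norm_smul, Real.norm_of_nonneg hh.le] at e1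
    have e2 : (δ * ‖x‖) ^ 2 ≤ ‖D x‖ ^ 2 := pow_le_pow_left₀ (by positivity) (hDδ x) 2
    have e3 : (h * ‖D b‖) ^ 2 ≤ h * (β * δ ^ 2 * ‖x‖ ^ 2) := by
      have e4 : h * Cb ^ 2 ≤ β * δ ^ 2 := by
        rw [← le_div_iff₀ (by positivity)]
        exact hhh₀.trans (min_le_left _ _)
      calc (h * ‖D b‖) ^ 2 ≤ (h * (Cb * ‖x‖)) ^ 2 := by gcongr
        _ = h * (h * Cb ^ 2 * ‖x‖ ^ 2) := by ring
        _ ≤ _ := by gcongr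
    have e5 : 2 * (c * h) * N x ^ 2 ≤ h * (β * δ ^ 2 * ‖x‖ ^ 2) := by
      calc 2 * (c * h) * N x ^ 2 ≤ 2 * (c * h) * (C * ‖x‖) ^ 2 := by gcongr; exact hNC x
        _ = _ := by rw [hc]; field_simp
    have e6 : h * inner ℝ (D (T (absSeq x))) (D b) ≤ h * (-β * (δ * ‖x‖) ^ 2) := by
      refine mul_le_mul_of_nonneg_left (hinner.trans ?_) hh.le
      nlinarith
    have e7 : ‖D (T (absSeq x))‖ = N x := rfl
    rw [e7] at e1
    nlinarith
  have hch : c * h ≤ 1 := by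
    rw [← le_div_iff₀' hcpos]
    exact hhh₀.trans (min_le_right _ _)
  refine (pow_le_pow_iff_left₀ (norm_nonneg _) (mul_nonneg (by linarith) hNx0) two_ne_zero).1 ?_
  refine hsq.trans ?_
  rw [mul_pow]
  gcongr
  nlinarith [sq_nonneg (c * h)]

/-! ### The drift on `V` and its Lipschitz extension. -/

theorem V.antitone {v : ℕ → ℝ} (hv : v ∈ V) : Antitone v := antitone_nat_of_succ_le hv.2.1

theorem V.nonneg {v : ℕ → ℝ} (hv : v ∈ V) (k : ℕ) : 0 ≤ v k :=
  (V.antitone hv).le_of_tendsto hv.2.2 k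

theorem V.le_one {v : ℕ → ℝ} (hv : v ∈ V) (k : ℕ) : v k ≤ 1 :=
  hv.1 ▸ V.antitone hv (Nat.zero_le k)

theorem abs_pow_sub_pow_le_of_mem_unit {a b : ℝ} (ha0 : 0 ≤ a) (ha1 : a ≤ 1) (hb0 : 0 ≤ b)
    (hb1 : b ≤ 1) (L : ℕ) : |a ^ L - b ^ L| ≤ L * |a - b| := by
  refine (abs_pow_sub_pow_le a b L).trans ?_
  rw [mul_comm |a - b|]
  refine mul_le_of_le_one_right (by positivity) (pow_le_one₀ (by positivity) ?_)
  rw [abs_of_nonneg ha0, abs_of_nonneg hb0]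
  exact max_le ha1 hb1

/-- The power function precomposed with the projection onto the unit interval. -/
noncomputable def clampPow (L : ℕ) (v : ℝ) : ℝ := max 0 (min v 1) ^ L

theorem clampPow_of_mem {v : ℝ} (h0 : 0 ≤ v) (h1 : v ≤ 1) (L : ℕ) : clampPow L v = v ^ L := by
  rw [clampPow, min_eq_left h1, max_eq_right h0]

theorem abs_clampPow_sub_le (L : ℕ) (a b : ℝ) : |clampPow L a - clampPow L b| ≤ L * |a - b| := by
  refine (abs_pow_sub_pow_le_of_mem_unit (le_max_left _ _) (max_le zero_le_one (min_le_right _ _))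
    (le_max_left _ _) (max_le zero_le_one (min_le_right _ _)) L).trans ?_
  refine mul_le_mul_of_nonneg_left ?_ (Nat.cast_nonneg L)
  refine (abs_max_sub_max_le_max _ _ _ _).trans (max_le (by simp) ?_)
  exact (abs_min_sub_min_le_max _ _ _ _).trans (max_le le_rfl (by simp))

/-- The drift with arrival rates made globally Lipschitz. -/
noncomputable def clampDrift (α β : ℝ) (L : ℕ) (v : ℕ → ℝ) : ℕ → ℝ
  | 0 => 0
  | k + 1 => α * (clampPow L (v k) - clampPow L (v (k + 1))) - β * (v (k + 1) - v (k + 2))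

theorem clampDrift_eq_F {v : ℕ → ℝ} (hv : v ∈ V) (α β : ℝ) (L k : ℕ) :
    clampDrift α β L v k = F α β L v k := by
  cases k with
  | zero => simp [clampDrift, F, Fplus, Fminus]
  | succ k =>
    simp [clampDrift, F, Fplus, Fminus, clampPow_of_mem (V.nonneg hv _) (V.le_one hv _)]

theorem abs_clampDrift_sub_le {α β s : ℝ} (hα : 0 ≤ α) (hβ : 0 ≤ β) (hs : 0 < s) (L : ℕ)
    {v v' d : ℕ → ℝ} (hd : ∀ k, v k - v' k = s ^ k * d k) (k : ℕ) :
    |(s ^ k)⁻¹ * clampDrift α β L v k - (s ^ k)⁻¹ * clampDrift α β L v' k|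
      ≤ (α * L * s⁻¹ + α * L + β + β * s) * (|d (k - 1)| + |d k| + |d (k + 1)|) := by
  cases k with
  | zero => simp only [clampDrift, mul_zero, sub_self, abs_zero]; positivity
  | succ k =>
    have habs : ∀ j, |v j - v' j| = s ^ j * |d j| := fun j => by
      rw [hd, abs_mul, abs_of_pos (pow_pos hs j)]
    have h1 := abs_clampPow_sub_le L (v k) (v' k)
    have h2 := abs_clampPow_sub_le L (v (k + 1)) (v' (k + 1))
    have h3 := habs (k + 1)
    have h4 := habs (k + 2)
    rw [habs] at h1 h2
    have hp : 0 < s ^ (k + 1) := pow_pos hs _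
    rw [← mul_sub, abs_mul, abs_of_pos (inv_pos.2 hp), inv_mul_le_iff₀ hp]
    have e : clampDrift α β L v (k + 1) - clampDrift α β L v' (k + 1) =
        α * (clampPow L (v k) - clampPow L (v' k))
        - α * (clampPow L (v (k + 1)) - clampPow L (v' (k + 1)))
        - β * (v (k + 1) - v' (k + 1)) + β * (v (k + 2) - v' (k + 2)) := by
      simp only [clampDrift]; ring
    rw [e]
    have t1 : |α * (clampPow L (v k) - clampPow L (v' k))| ≤ α * (L * (s ^ k * |d k|)) := by
      rw [abs_mul, abs_of_nonneg hα]; gcongr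
    have t2 : |α * (clampPow L (v (k + 1)) - clampPow L (v' (k + 1)))|
        ≤ α * (L * (s ^ (k + 1) * |d (k + 1)|)) := by
      rw [abs_mul, abs_of_nonneg hα]; gcongr
    have t3 : |β * (v (k + 1) - v' (k + 1))| = β * (s ^ (k + 1) * |d (k + 1)|) := by
      rw [abs_mul, abs_of_nonneg hβ, h3]
    have t4 : |β * (v (k + 2) - v' (k + 2))| = β * (s ^ (k + 2) * |d (k + 2)|) := by
      rw [abs_mul, abs_of_nonneg hβ, h4]
    refine (abs_add_le _ _).trans ?_
    refine (add_le_add_left ((abs_sub _ _).trans (add_le_add_left (abs_sub _ _) _)) _).trans ?_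
    rw [t3, t4]
    refine (add_le_add_left (add_le_add_left (add_le_add t1 t2) _) _).trans ?_
    have e2 : s ^ k = s ^ (k + 1) * s⁻¹ := by rw [pow_succ]; field_simp
    simp only [Nat.add_sub_cancel]
    rw [e2, pow_succ s (k + 1)]
    set p := s ^ (k + 1)
    have r1 : α * (L * (p * s⁻¹ * |d k|)) + α * (L * (p * |d (k + 1)|)) + β * (p * |d (k + 1)|)
        + β * (p * s * |d (k + 2)|) = p * (α * L * s⁻¹ * |d k| + (α * L + β) * |d (k + 1)|
        + β * s * |d (k + 2)|) := by ring
    rw [r1]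
    refine mul_le_mul_of_nonneg_left ?_ hp.le
    have c1 : 0 ≤ α * L * s⁻¹ := by positivity
    have c2 : 0 ≤ α * L := by positivity
    have c3 : 0 ≤ β * s := by positivity
    have q1 : 0 ≤ (α * L + β + β * s) * |d k| := by positivity
    have q2 : 0 ≤ (α * L * s⁻¹ + β * s) * |d (k + 1)| := by positivity
    have q3 : 0 ≤ (α * L * s⁻¹ + α * L + β) * |d (k + 2)| := by positivity
    have q4 : |d (k + 1 + 1)| = |d (k + 2)| := rfl
    rw [q4]
    nlinarith

/-- An Euler step with small step size preserves `V`. -/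
theorem V.euler_step {α β : ℝ} (hα : 0 ≤ α) (hβ : 0 ≤ β) (L : ℕ) {v : ℕ → ℝ} (hv : v ∈ V)
    {h : ℝ} (hh : 0 ≤ h) (hh1 : h * (α * L + β) ≤ 1) : (fun k => v k + h * F α β L v k) ∈ V := by
  have hmono := hv.2.1
  have hpow : ∀ k, v (k + 1) ^ L ≤ v k ^ L := fun k =>
    pow_le_pow_left₀ (V.nonneg hv _) (hmono k) L
  have hlip : ∀ k, v k ^ L - v (k + 1) ^ L ≤ L * (v k - v (k + 1)) := fun k => by
    have := abs_pow_sub_pow_le_of_mem_unit (V.nonneg hv k) (V.le_one hv k) (V.nonneg hv (k + 1))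
      (V.le_one hv (k + 1)) L
    rwa [abs_of_nonneg (sub_nonneg.2 (hpow k)), abs_of_nonneg (sub_nonneg.2 (hmono k))] at this
  -- The mass `v k - v (k + 1)` at site `k` leaves at rate at most `α L + β`, so a step with `h (α L
  -- + β) ≤ 1` cannot make it negative.
  have hstep : ∀ k, 0 ≤ (v k - v (k + 1)) - h * (α * (v k ^ L - v (k + 1) ^ L)
      + β * (v k - v (k + 1))) := fun k => by
    have h1 : α * (v k ^ L - v (k + 1) ^ L) + β * (v k - v (k + 1))
        ≤ (α * L + β) * (v k - v (k + 1)) := by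
      have := mul_le_mul_of_nonneg_left (hlip k) hα
      linarith
    have h2 := mul_le_mul_of_nonneg_left h1 hh
    have h3 := mul_le_mul_of_nonneg_right hh1 (sub_nonneg.2 (hmono k))
    linarith
  have hgain : ∀ k, 0 ≤ h * (α * (v k ^ L - v (k + 1) ^ L)) := fun k =>
    mul_nonneg hh (mul_nonneg hα (sub_nonneg.2 (hpow k)))
  have hloss : ∀ k, 0 ≤ h * (β * (v k - v (k + 1))) := fun k =>
    mul_nonneg hh (mul_nonneg hβ (sub_nonneg.2 (hmono k)))
  refine ⟨by simp [F, Fplus, Fminus, hv.1], fun k => ?_, ?_⟩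
  · cases k with
    | zero =>
      simp only [F, Fplus, Fminus, Pi.sub_apply]
      have := hstep 0
      have h1 := hloss 0
      have h2 := hloss 1
      simp only [zero_add] at *
      linarith
    | succ k =>
      simp only [F, Fplus, Fminus, Pi.sub_apply]
      have h1 := hstep (k + 1)
      have h2 := hloss (k + 2)
      have h3 := hgain k
      linarith
  · rw [← tendsto_add_atTop_iff_nat 1]
    have h0 := hv.2.2
    have h1 := (tendsto_add_atTop_iff_nat 1).2 h0
    have h2 := (tendsto_add_atTop_iff_nat 2).2 h0
    have := h1.add ((((h0.pow L).sub (h1.pow L)).const_mul α).sub ((h1.sub h2).const_mul β)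
      |>.const_mul h)
    simpa [F, Fplus, Fminus] using this

/-! ### The equilibrium. -/

theorem uTilde_zero (ρ : ℝ) (L : ℕ) : uTilde ρ L 0 = 1 := by simp [uTilde]

theorem uTilde_succ (ρ : ℝ) (L k : ℕ) : uTilde ρ L (k + 1) = ρ * uTilde ρ L k ^ L := by
  rw [uTilde, uTilde, Finset.sum_range_succ', ← pow_mul, pow_add, Finset.sum_mul, pow_zero,
    pow_one, mul_comm]
  simp only [pow_succ]

theorem uTilde_nonneg {ρ : ℝ} (h0 : 0 ≤ ρ) (L k : ℕ) : 0 ≤ uTilde ρ L k := pow_nonneg h0 _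

theorem uTilde_le_pow {ρ : ℝ} (h0 : 0 ≤ ρ) (h1 : ρ ≤ 1) {L : ℕ} (hL : 1 ≤ L) (k : ℕ) :
    uTilde ρ L k ≤ ρ ^ k := by
  refine pow_le_pow_of_le_one h0 h1 ?_
  calc k = ∑ _i ∈ Finset.range k, 1 := by simp
    _ ≤ _ := Finset.sum_le_sum fun i _ => Nat.one_le_pow _ _ hL

theorem uTilde_mem_V {ρ : ℝ} (h0 : 0 ≤ ρ) (h1 : ρ < 1) {L : ℕ} (hL : 1 ≤ L) :
    uTilde ρ L ∈ V := by
  refine ⟨uTilde_zero ρ L, fun k => pow_le_pow_of_le_one h0 h1.le ?_, ?_⟩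
  · rw [Finset.sum_range_succ]; exact Nat.le_add_right _ _
  · exact squeeze_zero (uTilde_nonneg h0 L) (uTilde_le_pow h0 h1.le hL)
      (tendsto_pow_atTop_nhds_zero_of_lt_one h0 h1)

theorem F_uTilde {α β : ℝ} (hβ : β ≠ 0) (L k : ℕ) : F α β L (uTilde (α / β) L) k = 0 := by
  cases k with
  | zero => simp [F, Fplus, Fminus]
  | succ k =>
    have h : ∀ j, β * uTilde (α / β) L (j + 1) = α * uTilde (α / β) L j ^ L := fun j => by
      rw [uTilde_succ]; field_simp
    simp only [F, Fplus, Fminus, Pi.sub_apply]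
    linarith [h k, h (k + 1)]

/-! ### Uniqueness of `V`-valued solutions. -/

/-- Picard iteration in the sup norm, started from the bound `1` that holds because both solutions
lie in the unit interval. The Lipschitz estimate with `s = 1` has coefficient `2 (α L + β)` on each
of three neighbours, hence the `6`. -/
theorem IsSolution.abs_sub_le {α β : ℝ} (hα : 0 ≤ α) (hβ : 0 ≤ β) {L : ℕ} {u v : ℝ → ℕ → ℝ}
    (hu : IsSolution α β L u) (hv : IsSolution α β L v) (h0 : u 0 = v 0) (n : ℕ) :
    ∀ t, 0 ≤ t → ∀ k,
      |u t k - v t k| ≤ (6 * (α * L + β) * t) ^ n / n.factorial := by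
  set C : ℝ := 6 * (α * L + β) with hC
  have hC0 : 0 ≤ C := by positivity
  induction n with
  | zero =>
    intro t ht k
    rw [pow_zero, Nat.factorial_zero, Nat.cast_one, div_one, abs_le]
    have h1 := V.nonneg (hu.1 t ht) k
    have h2 := V.nonneg (hv.1 t ht) k
    have h3 := V.le_one (hu.1 t ht) k
    have h4 := V.le_one (hv.1 t ht) k
    constructor <;> linarith
  | succ n ih =>
    intro t ht k
    rcases Nat.eq_zero_or_pos k with rfl | hk
    · rw [(hu.1 t ht).1, (hv.1 t ht).1, sub_self, abs_zero]
      positivity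
    have hd : ∀ r, 0 ≤ r → HasDerivWithinAt (fun r => u r k - v r k)
        (F α β L (u r) k - F α β L (v r) k) (Ici 0) r := fun r hr =>
      (hu.2 r hr k hk).sub (hv.2 r hr k hk)
    refine image_norm_le_of_norm_deriv_right_le_deriv_boundary
      (f := fun r => u r k - v r k) (f' := fun r => F α β L (u r) k - F α β L (v r) k)
      (a := 0) (b := t) (B := fun r => (C * r) ^ (n + 1) / (n + 1).factorial)
      (B' := fun r => C * ((C * r) ^ n / n.factorial))
      (fun r hr => (hd r hr.1).continuousWithinAt.mono Icc_subset_Ici_self)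
      (fun r hr => (hd r hr.1).mono (Ici_subset_Ici.2 hr.1)) ?_ (fun r => ?_) (fun r hr => ?_)
      ⟨ht, le_rfl⟩
    · simp [h0]
    · have h1 := (((hasDerivAt_id r).const_mul C).pow (n + 1)).div_const
        ((n + 1).factorial : ℝ)
      refine h1.congr_deriv ?_
      have : (n.factorial : ℝ) ≠ 0 := by positivity
      rw [Nat.factorial_succ]
      push_cast
      simp only [id, mul_one]
      field_simp
    · have h1 := abs_clampDrift_sub_le hα hβ one_pos L (v := u r) (v' := v r)
        (d := fun j => u r j - v r j) (fun j => by rw [one_pow, one_mul]) k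
      rw [clampDrift_eq_F (hu.1 r hr.1), clampDrift_eq_F (hv.1 r hr.1), one_pow, inv_one, one_mul,
        one_mul] at h1
      refine h1.trans ?_
      have i1 := ih r hr.1 (k - 1)
      have i2 := ih r hr.1 k
      have i3 := ih r hr.1 (k + 1)
      have hcf : α * L * 1 + α * L + β + β * 1 = C / 3 := by rw [hC]; ring
      rw [hcf]
      calc _ ≤ C / 3 * ((C * r) ^ n / n.factorial + (C * r) ^ n / n.factorial
            + (C * r) ^ n / n.factorial) := by gcongr
        _ = _ := by ring

theorem IsSolution.unique {α β : ℝ} (hα : 0 ≤ α) (hβ : 0 ≤ β) {L : ℕ} {u v : ℝ → ℕ → ℝ}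
    (hu : IsSolution α β L u) (hv : IsSolution α β L v) (h0 : u 0 = v 0) {t : ℝ} (ht : 0 ≤ t) :
    u t = v t := by
  funext k
  have h := ge_of_tendsto'
    (FloorSemiring.tendsto_pow_div_factorial_atTop (6 * (α * L + β) * t))
    fun n => hu.abs_sub_le hα hβ hv h0 n t ht k
  exact sub_eq_zero.1 (abs_nonpos_iff.1 h)

/-! ### Weighted coordinates around the equilibrium. -/

theorem exists_lipschitz_field {α β s : ℝ} (hα : 0 ≤ α) (hβ : 0 ≤ β) (hs : 0 < s) (L : ℕ)
    {w : ℕ → ℝ} (hw : w ∈ V) (hFw : ∀ k, F α β L w k = 0) :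
    ∃ (G : EllTwo → EllTwo) (K : ℝ≥0), LipschitzWith K G ∧
      ∀ x k, G x k = (s ^ k)⁻¹ * clampDrift α β L (fun j => w j + s ^ j * x j) k := by
  set c : ℝ := α * L * s⁻¹ + α * L + β + β * s with hc
  have hc0 : 0 ≤ c := by positivity
  have hdiff : ∀ x y : EllTwo, ∀ k,
      |(s ^ k)⁻¹ * clampDrift α β L (fun j => w j + s ^ j * x j) k
        - (s ^ k)⁻¹ * clampDrift α β L (fun j => w j + s ^ j * y j) k|
      ≤ c * (|(x - y) (k - 1)| + |(x - y) k| + |(x - y) (k + 1)|) := fun x y k =>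
    abs_clampDrift_sub_le hα hβ hs L (fun j => by
      simp only [lp.coeFn_sub, Pi.sub_apply]; ring) k
  have hmem : ∀ x : EllTwo,
      Memℓp (fun k => (s ^ k)⁻¹ * clampDrift α β L (fun j => w j + s ^ j * x j) k) 2 := fun x => by
    refine memℓp_two_iff.2 (summable_sq_of_abs_le_neighbours (c := c) x.summable_sq
      fun k => ?_).1
    -- The field vanishes at the origin, since `w` is an equilibrium; the Lipschitz bound against
    -- `0` therefore gives square summability.
    have := hdiff x 0 k
    have hw0 : (fun j => w j + s ^ j * (0 : EllTwo) j) = w := by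
      funext j; simp
    rw [hw0, clampDrift_eq_F hw, hFw, mul_zero, sub_zero, sub_zero] at this
    exact this
  refine ⟨fun x => ⟨_, hmem x⟩, Real.toNNReal (4 * c), ?_, fun _ _ => rfl⟩
  refine LipschitzWith.of_dist_le_mul fun x y => ?_
  rw [dist_eq_norm, dist_eq_norm, Real.coe_toNNReal _ (by positivity)]
  exact EllTwo.norm_le_of_abs_le_neighbours hc0 (hdiff x y)

/-- Only the term `i = L - 1` lacks a factor `b`. With `b = ũ(k) ≤ ρᵏ`, the secant slope of the
power exceeds `1` by a summable amount. -/
theorem sum_pow_mul_pow_le {a b : ℝ} (ha0 : 0 ≤ a) (ha1 : a ≤ 1) (hb0 : 0 ≤ b) (hb1 : b ≤ 1)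
    (L : ℕ) : ∑ i ∈ Finset.range L, a ^ i * b ^ (L - 1 - i) ≤ 1 + L * b := by
  cases L with
  | zero => simp
  | succ n =>
    rw [Finset.sum_range_succ, add_comm]
    refine add_le_add ?_ ?_
    · simpa using pow_le_one₀ ha0 ha1
    · calc _ ≤ ∑ _i ∈ Finset.range n, b := Finset.sum_le_sum fun i hi => by
            have hin := Finset.mem_range.1 hi
            calc a ^ i * b ^ (n + 1 - 1 - i) ≤ 1 * b ^ 1 :=
                  mul_le_mul (pow_le_one₀ ha0 ha1)
                    (pow_le_pow_of_le_one hb0 hb1 (by omega)) (by positivity) zero_le_one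
              _ = b := by ring
        _ = n * b := by simp
        _ ≤ _ := by gcongr; exact Nat.le_succ n

theorem sum_pow_mul_pow_le_natCast {a b : ℝ} (ha0 : 0 ≤ a) (ha1 : a ≤ 1) (hb0 : 0 ≤ b)
    (hb1 : b ≤ 1) (L : ℕ) : ∑ i ∈ Finset.range L, a ^ i * b ^ (L - 1 - i) ≤ L := by
  calc _ ≤ ∑ _i ∈ Finset.range L, (1 : ℝ) := Finset.sum_le_sum fun i _ =>
        mul_le_one₀ (pow_le_one₀ ha0 ha1) (by positivity) (pow_le_one₀ hb0 hb1)
    _ = L := by simp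

/-- Along an Euler step, absolute deviations from an equilibrium are controlled by `tailFlux`. -/
theorem abs_euler_step_le {α β s h : ℝ} (hα : 0 ≤ α) (hβ : 0 ≤ β) (hs : 0 < s) {L : ℕ}
    {v w x : ℕ → ℝ} (hv : v ∈ V) (hw : w ∈ V) (hFw : ∀ k, F α β L w k = 0)
    (hx : ∀ k, v k = w k + s ^ k * x k) (hh : 0 ≤ h) (hh1 : h * (α * L + β) ≤ 1) {m : ℕ → ℝ}
    (hm : ∀ k, m k = ∑ i ∈ Finset.range L, v k ^ i * w k ^ (L - 1 - i)) (k : ℕ) :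
    |x k + h * ((s ^ k)⁻¹ * F α β L v k)|
      ≤ |x k| + h * (tailFlux α β s m x k - s * tailFlux α β s m x (k + 1)) := by
  have hm0 : ∀ k, 0 ≤ m k := fun k => by
    rw [hm]
    exact Finset.sum_nonneg fun i _ =>
      mul_nonneg (pow_nonneg (V.nonneg hv k) _) (pow_nonneg (V.nonneg hw k) _)
  have hmL : ∀ k, m k ≤ L := fun k => by
    rw [hm]
    exact sum_pow_mul_pow_le_natCast (V.nonneg hv k) (V.le_one hv k) (V.nonneg hw k)
      (V.le_one hw k) L
  have hpow : ∀ k, v k ^ L - w k ^ L = m k * (s ^ k * x k) := fun k => by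
    rw [← geom_sum₂_mul, ← hm, hx k]; ring
  have hx0 : x 0 = 0 := by
    have := hx 0
    rw [hv.1, hw.1] at this
    simpa using this
  cases k with
  | zero =>
    simp only [F, Fplus, Fminus, Pi.sub_apply, tailFlux, hx0, abs_zero]
    have : 0 ≤ h * (s * (β * |x 1|)) := by positivity
    simp only [sub_self, mul_zero, add_zero, abs_zero, zero_add]
    linarith
  | succ k =>
    have hp : 0 < s ^ (k + 1) := pow_pos hs _
    have e : (s ^ (k + 1))⁻¹ * F α β L v (k + 1) = α * s⁻¹ * m k * x k
        - (α * m (k + 1) + β) * x (k + 1) + β * s * x (k + 2) := by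
      have hF : F α β L v (k + 1) = F α β L v (k + 1) - F α β L w (k + 1) := by
        rw [hFw, sub_zero]
      rw [hF]
      simp only [F, Fplus, Fminus, Pi.sub_apply]
      have e1 : α * (v k ^ L - v (k + 1) ^ L) - β * (v (k + 1) - v (k + 2))
          - (α * (w k ^ L - w (k + 1) ^ L) - β * (w (k + 1) - w (k + 2)))
          = α * (v k ^ L - w k ^ L) - α * (v (k + 1) ^ L - w (k + 1) ^ L)
            - β * (v (k + 1) - w (k + 1)) + β * (v (k + 2) - w (k + 2)) := by ring
      rw [e1, hpow, hpow, hx (k + 1), hx (k + 2), inv_mul_eq_iff_eq_mul₀ hp.ne']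
      field_simp
      ring
    rw [e]
    -- All coefficients of the step are now nonnegative, so the triangle inequality yields exactly
    -- the flux difference.
    have hfac : 0 ≤ 1 - h * (α * m (k + 1) + β) := by
      have : h * (α * m (k + 1) + β) ≤ h * (α * L + β) := by gcongr; exact hmL _
      linarith
    have hr : x (k + 1) + h * (α * s⁻¹ * m k * x k - (α * m (k + 1) + β) * x (k + 1)
        + β * s * x (k + 2)) = (1 - h * (α * m (k + 1) + β)) * x (k + 1)
        + (h * (α * s⁻¹ * m k)) * x k + (h * (β * s)) * x (k + 2) := by ring
    have c1 : 0 ≤ h * (α * s⁻¹ * m k) := by have := hm0 k; positivity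
    have c2 : 0 ≤ h * (β * s) := by positivity
    rw [hr]
    refine (abs_add_le _ _).trans ((add_le_add_left (abs_add_le _ _) _).trans (le_of_eq ?_))
    rw [abs_mul _ (x (k + 1)), abs_mul _ (x k), abs_mul _ (x (k + 2)), abs_of_nonneg hfac,
      abs_of_nonneg c1, abs_of_nonneg c2]
    simp only [tailFlux]
    field_simp
    ring

theorem isClosed_preimage_V {s : ℝ} (hs0 : 0 ≤ s) (hs1 : s < 1) {w : ℕ → ℝ} (hw : w ∈ V) :
    IsClosed {x : EllTwo | (fun k => w k + s ^ k * x k) ∈ V} := by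
  have hcoord : ∀ k, Continuous fun x : EllTwo => w k + s ^ k * x k := fun k =>
    continuous_const.add (continuous_const.mul
      (lp.evalCLM ℝ (fun _ : ℕ => ℝ) 2 k).continuous)
  have heq : {x : EllTwo | (fun k => w k + s ^ k * x k) ∈ V} =
      {x : EllTwo | w 0 + s ^ 0 * x 0 = 1} ∩
        ⋂ k : ℕ, {x : EllTwo | w (k + 1) + s ^ (k + 1) * x (k + 1) ≤ w k + s ^ k * x k} := by
    ext x
    simp only [V, mem_ofPred_eq, mem_inter_iff, mem_iInter]
    refine ⟨fun h => ⟨h.1, h.2.1⟩, fun h => ⟨h.1, h.2, ?_⟩⟩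
    -- The limit condition in `V` is automatic here, so only closed conditions on finitely many
    -- coordinates each remain.
    have h1 : Tendsto (fun k => s ^ k * x k) atTop (𝓝 0) := by
      refine squeeze_zero_norm (a := fun k => s ^ k * ‖x‖) (fun k => ?_) ?_
      · rw [norm_mul, Real.norm_of_nonneg (pow_nonneg hs0 k)]
        gcongr
        exact lp.norm_apply_le_norm two_ne_zero x k
      · simpa using (tendsto_pow_atTop_nhds_zero_of_lt_one hs0 hs1).mul_const ‖x‖
    simpa using hw.2.2.add h1
  rw [heq]
  exact (isClosed_eq (hcoord 0) continuous_const).inter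
    (isClosed_iInter fun k => isClosed_le (hcoord (k + 1)) (hcoord k))

theorem finiteL2_and_norm_eq {s : ℝ} (hs : 0 < s) (x : EllTwo) (hx0 : x 0 = 0) {y : ℕ → ℝ}
    (hy : ∀ k, y k = s ^ k * x k) :
    y ∈ L2 (g (s ^ 2)) ∧ L2norm (g (s ^ 2)) y = ‖x‖ := by
  have hterm : ∀ k, y k ^ 2 * (g (s ^ 2) k)⁻¹ = x k ^ 2 := fun k => by
    have : s ^ k ≠ 0 := (pow_pos hs k).ne'
    rw [hy, g, ← pow_mul, mul_comm 2 k, pow_mul]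
    field_simp
  refine ⟨⟨by rw [hy, hx0, mul_zero], ?_⟩, ?_⟩
  · simp only [FiniteL2, hterm]
    exact summable_sq_succ x.summable_sq
  · simp only [L2norm, hterm]
    rw [Real.sqrt_eq_iff_mul_self_eq (tsum_nonneg fun _ => sq_nonneg _) (norm_nonneg _), ← sq,
      x.norm_sq, x.summable_sq.tsum_eq_zero_add, hx0]
    ring

theorem finiteL2_uTilde {ρ θ : ℝ} (h0 : 0 < ρ) (h1 : ρ < 1) (hθ : ρ ≤ θ) {L : ℕ} (hL : 1 ≤ L) :
    FiniteL2 (g θ) (uTilde ρ L) := by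
  have hs := (summable_nat_add_iff 1).2 (summable_geometric_of_lt_one h0.le h1)
  have hθ0 : 0 < θ := h0.trans_le hθ
  refine hs.of_nonneg_of_le (fun k => ?_) fun k => ?_
  · have : 0 ≤ (g θ (k + 1))⁻¹ := inv_nonneg.2 (pow_nonneg hθ0.le _)
    positivity
  · have hg : 0 < θ ^ (k + 1) := pow_pos hθ0 _
    rw [g, ← div_eq_mul_inv, div_le_iff₀ hg]
    calc uTilde ρ L (k + 1) ^ 2 ≤ (ρ ^ (k + 1)) ^ 2 :=
          pow_le_pow_left₀ (uTilde_nonneg h0.le L _) (uTilde_le_pow h0.le h1.le hL _) 2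
      _ = ρ ^ (k + 1) * ρ ^ (k + 1) := sq _
      _ ≤ _ := by gcongr

theorem exists_coordinates {s : ℝ} {v w : ℕ → ℝ} (hv : FiniteL2 (g (s ^ 2)) v)
    (hw : FiniteL2 (g (s ^ 2)) w) : ∃ x : EllTwo, ∀ k, x k = (s ^ k)⁻¹ * (v k - w k) := by
  refine ⟨⟨fun k => (s ^ k)⁻¹ * (v k - w k), memℓp_two_iff.2 ?_⟩, fun _ => rfl⟩
  rw [← summable_nat_add_iff 1]
  refine ((hv.add hw).mul_left 2).of_nonneg_of_le (fun _ => sq_nonneg _) fun k => ?_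
  have hg : 0 ≤ (g (s ^ 2) (k + 1))⁻¹ := inv_nonneg.2 (pow_nonneg (sq_nonneg s) _)
  have he : ((s ^ (k + 1))⁻¹) ^ 2 = (g (s ^ 2) (k + 1))⁻¹ := by
    rw [g, inv_pow, ← pow_mul, ← pow_mul, mul_comm]
  rw [mul_pow, he]
  nlinarith [mul_nonneg hg (sq_nonneg (v (k + 1) + w (k + 1)))]

/-- With `w k = exp (-(L/2) ∑_{j<k} ρʲ)` the ratio of consecutive squares is `exp (-L ρᵏ)`, and
convergence of the geometric series keeps `w` away from `0`. -/
theorem exists_weights {ρ : ℝ} (h0 : 0 ≤ ρ) (h1 : ρ < 1) (L : ℕ) :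
    ∃ (w : ℕ → ℝ) (δ : ℝ), 0 < δ ∧ (∀ k, δ ≤ w k) ∧ (∀ k, w k ≤ 1) ∧
      ∀ k, w (k + 1) ^ 2 * (1 + L * ρ ^ k) ≤ w k ^ 2 := by
  refine ⟨fun k => Real.exp (-(L / 2 * ∑ j ∈ Finset.range k, ρ ^ j)),
    Real.exp (-(L / 2 * (1 - ρ)⁻¹)), Real.exp_pos _, fun k => ?_, fun k => ?_, fun k => ?_⟩
  · have : ∑ j ∈ Finset.range k, ρ ^ j ≤ (1 - ρ)⁻¹ := by
      rw [← tsum_geometric_of_lt_one h0 h1]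
      exact (summable_geometric_of_lt_one h0 h1).sum_le_tsum _ fun _ _ => pow_nonneg h0 _
    simp only [Real.exp_le_exp, neg_le_neg_iff]
    gcongr
  · rw [Real.exp_le_one_iff, neg_nonpos]
    have : 0 ≤ ∑ j ∈ Finset.range k, ρ ^ j := Finset.sum_nonneg fun _ _ => pow_nonneg h0 _
    positivity
  · have h2 : 1 + L * ρ ^ k ≤ Real.exp (L * ρ ^ k) := by
      linarith [Real.add_one_le_exp (L * ρ ^ k)]
    refine (mul_le_mul_of_nonneg_left h2 (sq_nonneg _)).trans (le_of_eq ?_)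
    simp only [Finset.sum_range_succ, ← Real.exp_nat_mul, ← Real.exp_add]
    congr 1
    push_cast
    ring

/-! ### Assembly of the theorem. -/

/-- Global existence, uniqueness and exponential stability of the equilibrium in `L₂(g_θ)`. -/
theorem exists_exponential_decay (α β : ℝ) (hα : 0 < α) (hαβ : α < β) (L : ℕ) (hL : 1 ≤ L)
    (θ : ℝ) (hρθ : α / β ≤ θ) (hθ : θ < 1) :
    ∃ γ : ℝ, 0 < γ ∧ ∃ C : ℝ,
      ∀ u₀ ∈ VL2 (g θ),
        ∃ u : ℝ → ℕ → ℝ,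
          IsSolution α β L u ∧ u 0 = u₀ ∧
          (∀ v : ℝ → ℕ → ℝ, IsSolution α β L v → v 0 = u₀ →
            ∀ t : ℝ, 0 ≤ t → v t = u t) ∧
          ∀ t : ℝ, 0 ≤ t →
            u t - uTilde (α / β) L
              ∈ L2 (g θ) ∧
            L2norm (g θ)
                (u t - uTilde (α / β) L)
              ≤ Real.exp (-γ * t) * C *
                L2norm (g θ)
                  (u₀ - uTilde (α / β) L) := by
  have hβ : 0 < β := hα.trans hαβ
  set ρ := α / β with hρ
  have hρ0 : 0 < ρ := div_pos hα hβ
  have hρ1 : ρ < 1 := hρθ.trans_lt hθ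
  have hθ0 : 0 < θ := hρ0.trans_le hρθ
  obtain ⟨s, hs0, hsθ⟩ : ∃ s : ℝ, 0 < s ∧ s ^ 2 = θ :=
    ⟨√θ, Real.sqrt_pos.2 hθ0, Real.sq_sqrt hθ0.le⟩
  have hs1 : s < 1 := by nlinarith
  subst hsθ
  set w := uTilde ρ L with hwdef
  have hw : w ∈ V := uTilde_mem_V hρ0.le hρ1 hL
  have hFw : ∀ k, F α β L w k = 0 := F_uTilde hβ.ne' L
  obtain ⟨G, K, hGK, hG⟩ := exists_lipschitz_field hα.le hβ.le hs0 L hw hFw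
  obtain ⟨d, δ, hδ, hdδ, hd1, hdM⟩ := exists_weights hρ0.le hρ1 L
  have hM0 : ∀ k, 0 ≤ 1 + L * ρ ^ k := fun k => by positivity
  obtain ⟨N, C, C', c, h₀, hC, hC', hc, hh₀, hNlip, hNC, hNC', hNstep⟩ :=
    exists_lyapunov (B := 1 + L) hα.le hβ hs0 hs1
      (by rwa [hρ, div_le_iff₀' hβ] at hρθ) hM0
      (fun k => by
        have : (L : ℝ) * ρ ^ k ≤ L * 1 := by gcongr; exact pow_le_one₀ hρ0.le hρ1.le
        linarith) hδ hdδ hd1 hdM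
  set S : Set EllTwo := {x | (fun k => w k + s ^ k * x k) ∈ V} with hS
  have hSclosed : IsClosed S := isClosed_preimage_V hs0.le hs1 hw
  have hGF : ∀ x ∈ S, ∀ k, G x k = (s ^ k)⁻¹ * F α β L (fun j => w j + s ^ j * x j) k :=
    fun x hx k => by rw [hG, clampDrift_eq_F hx]
  set h₁ : ℝ := 1 / (α * L + β) with hh₁
  have hαLβ : 0 < α * L + β := by positivity
  have hh₁0 : 0 < h₁ := by positivity
  have hSstep : ∀ x ∈ S, ∀ h, 0 < h → h ≤ h₁ → x + h • G x ∈ S := fun x hx h hh hhh => by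
    have hxV : (fun k => w k + s ^ k * x k) ∈ V := hx
    have h1 := V.euler_step hα.le hβ.le L hxV hh.le ((le_div_iff₀ hαLβ).1 hhh)
    have h2 : (fun k => w k + s ^ k * (x + h • G x) k) = fun k => (fun j => w j + s ^ j * x j) k
        + h * F α β L (fun j => w j + s ^ j * x j) k := by
      funext k
      have hp : s ^ k ≠ 0 := (pow_pos hs0 k).ne'
      simp only [lp.coeFn_add, lp.coeFn_smul, Pi.add_apply, Pi.smul_apply, smul_eq_mul, hGF x hx k]
      field_simp
      ring
    rw [hS, mem_ofPred_eq, h2]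
    exact h1
  have hNS : ∀ x ∈ S, ∀ h, 0 < h → h ≤ min h₀ h₁ → N (x + h • G x) ≤ (1 + -c * h) * N x :=
    fun x hx h hh hhh => by
      have hxV : (fun k => w k + s ^ k * x k) ∈ V := hx
      have h1 : h * (α * L + β) ≤ 1 := (le_div_iff₀ hαLβ).1 (hhh.trans (min_le_right _ _))
      rw [neg_mul, ← sub_eq_add_neg]
      -- Here `m k` is the secant slope of the `L`-th power between `w k` and `w k + s ^ k * x k`.
      refine hNstep x _ (fun k => ∑ i ∈ Finset.range L,
        (w k + s ^ k * x k) ^ i * w k ^ (L - 1 - i)) h (fun k => ?_) (fun k => ?_) hh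
        (hhh.trans (min_le_left _ _)) fun k => ?_
      · exact Finset.sum_nonneg fun i _ =>
          mul_nonneg (pow_nonneg (V.nonneg hxV k) _) (pow_nonneg (V.nonneg hw k) _)
      · refine (sum_pow_mul_pow_le (V.nonneg hxV k) (V.le_one hxV k) (V.nonneg hw k)
          (V.le_one hw k) L).trans ?_
        gcongr
        exact uTilde_le_pow hρ0.le hρ1.le hL k
      · have := abs_euler_step_le hα.le hβ.le hs0 hxV hw hFw (fun _ => rfl) hh.le h1
          (fun _ => rfl) k
        rw [← hGF x hx k] at this
        exact this
  refine ⟨c, hc, C' * C, fun u₀ hu₀ => ?_⟩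
  obtain ⟨x₀, hx₀⟩ := exists_coordinates hu₀.2 (finiteL2_uTilde hρ0 hρ1 hρθ hL)
  have hx₀u : (fun k => w k + s ^ k * x₀ k) = u₀ := by
    funext k
    rw [hx₀, mul_inv_cancel_left₀ (pow_pos hs0 k).ne', hwdef]
    ring
  have hx₀S : x₀ ∈ S := by rw [hS, mem_ofPred_eq, hx₀u]; exact hu₀.1
  obtain ⟨x, hx0, hx⟩ := exists_solution_Ici hGK x₀
  have hxS : ∀ t, 0 ≤ t → x t ∈ S := fun t ht =>
    mem_of_euler_step hGK hSclosed hh₁0 hSstep hx (by rwa [hx0]) ht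
  have hS0 : ∀ y ∈ S, y 0 = 0 := fun y hy => by
    have h1 := hy.1
    have h2 := hw.1
    simp only [pow_zero, one_mul] at h1
    linarith
  set u : ℝ → ℕ → ℝ := fun t k => w k + s ^ k * x t k with hu
  have hu0 : u 0 = u₀ := by rw [hu]; simp only [hx0]; exact hx₀u
  have husol : IsSolution α β L u := by
    refine ⟨hxS, fun t ht k _ => ?_⟩
    have h1 : HasDerivWithinAt (fun r => x r k) (G (x t) k) (Ici 0) t := by
      have := (lp.evalCLM ℝ (fun _ : ℕ => ℝ) 2 k).hasFDerivAt.comp_hasDerivWithinAt t (hx t ht)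
      exact this
    have h2 := (h1.const_mul (s ^ k)).const_add (w k)
    rw [hGF _ (hxS t ht), mul_inv_cancel_left₀ (pow_pos hs0 k).ne'] at h2
    exact h2
  refine ⟨u, husol, hu0, fun v hv hv0 t ht =>
    hv.unique hα.le hβ.le husol (hv0.trans hu0.symm) ht, fun t ht => ?_⟩
  have key : ∀ r, 0 ≤ r → u r - w ∈ L2 (g (s ^ 2)) ∧ L2norm (g (s ^ 2)) (u r - w) = ‖x r‖ :=
    fun r hr => finiteL2_and_norm_eq hs0 (x r) (hS0 _ (hxS r hr)) fun k => by
      simp only [hu, Pi.sub_apply]; ring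
  refine ⟨(key t ht).1, ?_⟩
  rw [(key t ht).2, ← hu0, (key 0 le_rfl).2]
  have hdecay := le_exp_mul_of_euler_step hC hNlip (lt_min hh₀ hh₁0) hx
    (fun r hr => hNS _ (hxS r hr)) ht
  calc ‖x t‖ ≤ C' * N (x t) := hNC' _
    _ ≤ C' * (Real.exp (-c * t) * (C * ‖x 0‖)) := by
        gcongr
        exact hdecay.trans (by gcongr; exact hNC _)
    _ = _ := by ring

end JoinShortestQueue

theorem mainTheorem2 (α β : ℝ) (hα : 0 < α) (hαβ : α < β) (L : ℕ) (hL : 1 ≤ L)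
    (θ : ℝ) (hρθ : α / β ≤ θ) (hθ : θ < 1) :
    ∃ γ : ℝ, 0 < γ ∧ ∃ C : ℝ,
      ∀ u₀ ∈ JoinShortestQueue.VL2 (JoinShortestQueue.g θ),
        ∃ u : ℝ → ℕ → ℝ,
          JoinShortestQueue.IsSolution α β L u ∧ u 0 = u₀ ∧
          (∀ v : ℝ → ℕ → ℝ, JoinShortestQueue.IsSolution α β L v → v 0 = u₀ →
            ∀ t : ℝ, 0 ≤ t → v t = u t) ∧
          ∀ t : ℝ, 0 ≤ t →
            u t - JoinShortestQueue.uTilde (α / β) L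
              ∈ JoinShortestQueue.L2 (JoinShortestQueue.g θ) ∧
            JoinShortestQueue.L2norm (JoinShortestQueue.g θ)
                (u t - JoinShortestQueue.uTilde (α / β) L)
              ≤ Real.exp (-γ * t) * C *
                JoinShortestQueue.L2norm (JoinShortestQueue.g θ)
                  (u₀ - JoinShortestQueue.uTilde (α / β) L) :=
  JoinShortestQueue.exists_exponential_decay α β hα hαβ L hL θ hρθ hθ
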